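/- Let $K$ be a (not necessarily commutative) field contained in a ring $R$ with $1_K=1_R\ne 0$. The points of the chain geometry $\Sigma(K,R)$ are the cyclic submodules $R(1,0)^\gamma$, $\gamma\in GL_2(R)$, of the free left module $R^2$, on which $GL_2(R)$ acts from the right; its chains are the images under $GL_2(R)$ of the standard chain $\{R(k,l)\mid (k,l)\in K^2\setminus\{(0,0)\}\}$. An isomorphism of chain geometries is a bijection between the point sets that maps the set of chains onto the set of chains. Two points are distant if they are different and lie on a common chain. A set $U$ of points is a subspace if, with any three pairwise distant points, it contains every chain through them; $U$ is then endowed with all the chains that are contained in $U$. An algebra $S\neq 0$ (associative, with $1$) over a commutative field $L$ (identified with $L\cdot 1_S\subseteq S$) is called strong if for every $a\in S$ there are at least two elements $k\in L$ such that $a+k$ is a unit of $S$. Let $K=GF(4)$ be embedded as a subfield, with the same $1$, into the ring $R=M(2\times 2,GF(2))$. Then: (a) $\Sigma(K,R)$ is not isomorphic to $\Sigma(L,S)$ for any commutative field $L$ and any $L$-algebra $S\ne 0$. (b) For any commutative field $L$ and any strong $L$-algebra $S$, $\Sigma(K,R)$ is not isomorphic to any subspace of $\Sigma(L,S)$ (with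 the induced chains); that is, $\Sigma(K,R)$ cannot be embedded into $\Sigma(L,S)$ as a subspace. -/

import Mathlib

/-- A set of points together with a set of distinguished subsets, the chains. -/
structure ChainStructure where
  /-- the points -/
  Point : Type*
  /-- the chains -/
  chains : Set (Set Point)

namespace ChainStructure

/-- Two points are distant if they are different and joined by at least one chain. -/
def Distant (A : ChainStructure) (p q : A.Point) : Prop :=
  p ≠ q ∧ ∃ C ∈ A.chains, p ∈ C ∧ q ∈ C

/-- An isomorphism is a bijection of the points that maps the chains of `A`
exactly to the chains of `B`. -/
structure Iso (A B : ChainStructure) where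
  /-- the bijection of the points -/
  toEquiv : A.Point ≃ B.Point
  map_chains : ∀ C : Set A.Point, toEquiv '' C ∈ B.chains ↔ C ∈ A.chains

/-- The structure induced on a set `U` of points: its chains are the chains contained in `U`. -/
def induced (A : ChainStructure) (U : Set A.Point) : ChainStructure where
  Point := U
  chains := {C | (Subtype.val '' C : Set A.Point) ∈ A.chains}

/-- A set `U` of points is a subspace if it contains, with any three pairwise distant points,
each chain through them. -/
def IsSubspace (A : ChainStructure) (U : Set A.Point) : Prop :=
  ∀ p ∈ U, ∀ q ∈ U, ∀ r ∈ U, A.Distant p q → A.Distant p r → A.Distant q r →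
    ∀ C ∈ A.chains, p ∈ C → q ∈ C → r ∈ C → C ⊆ U

/-- `B` can be embedded into `A` as a subspace. -/
def EmbedsAsSubspace (B A : ChainStructure) : Prop :=
  ∃ U : Set A.Point, A.IsSubspace U ∧ Nonempty (Iso B (A.induced U))

end ChainStructure

/-- The (right) action of `γ ∈ GL₂(R)` on the submodules of the left `R`-module `R²`,
induced by `v ↦ v γ` on row vectors. -/
def glAct {R : Type*} [Ring R] (γ : (Matrix (Fin 2) (Fin 2) R)ˣ)
    (p : Submodule R (Fin 2 → R)) : Submodule R (Fin 2 → R) :=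
  p.map (Matrix.vecMulLinear (γ : Matrix (Fin 2) (Fin 2) R))

/-- The cyclic submodule `R(a,b)` of the left module `R²`. -/
def cyclicSubmodule {R : Type*} [Ring R] (a b : R) : Submodule R (Fin 2 → R) :=
  Submodule.span R {![a, b]}

/-- The projective line over `R`: the orbit of `R(1,0)` under `GL₂(R)`. -/
def projectiveLine (R : Type*) [Ring R] : Set (Submodule R (Fin 2 → R)) :=
  {p | ∃ γ : (Matrix (Fin 2) (Fin 2) R)ˣ, p = glAct γ (cyclicSubmodule 1 0)}

/-- The standard chain: the projective line over the (skew) field `K`, embedded into the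
projective line over `R` via `K(k,l) ↦ R(k,l)`. -/
def standardChain {K R : Type*} [DivisionRing K] [Ring R] (i : K →+* R) :
    Set (Submodule R (Fin 2 → R)) :=
  {p | ∃ k l : K, (k ≠ 0 ∨ l ≠ 0) ∧ p = cyclicSubmodule (i k) (i l)}

/-- The chain geometry `Σ(K,R)` over a ring `R ≠ 0` with a distinguished (skew) subfield `K`,
given by its inclusion `i` (not necessarily central). The chains are the images of the
standard chain under `GL₂(R)`. -/
def chainGeometry {K R : Type*} [DivisionRing K] [Ring R] (i : K →+* R) : ChainStructure where
  Point := projectiveLine R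
  chains := {C | ∃ γ : (Matrix (Fin 2) (Fin 2) R)ˣ,
    (Subtype.val '' C : Set (Submodule R (Fin 2 → R))) = glAct γ '' standardChain i}

/-- An `L`-algebra `S` is strong if for each `a ∈ S` there are at least two scalars `k ∈ L`
such that `a + k` is a unit of `S`. -/
def IsStrongAlgebra (L S : Type*) [Field L] [Ring S] [Algebra L S] : Prop :=
  ∀ a : S, ∃ k l : L, k ≠ l ∧ IsUnit (a + algebraMap L S k) ∧ IsUnit (a + algebraMap L S l)

/-!
The invariant is the number of chains joining two distant points. If `K*` is normal in `R*`, these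
chains are, after moving the two points to `R(0,1)` and `R(1,0)`, the completed lines `Ku ∪ {∞}`
with `u` a unit of `R`, so their number is the index of `K*` in `R*`. As `GF(4)*` has order 3 and
`GL₂(2)` has order 6, there are exactly two of them in `Σ(K,R)`.

(a) Suppose that `L*` has index 2 in `S*`, where `L` is central. For a unit `u` outside `L` and
`a ∈ L*`, the element `u + a` is not a unit: otherwise it would lie in the coset of `u`, so that
`u + a ∈ Lu` and `u ∈ L`. But `u² ∈ L` and `(u + a)(u - a) = u² - a²`, so that `a² = u²` for all
`a ∈ L*`. Hence `L` has at most 3 elements, whereas the chains of `Σ(K,R)` have 5 points.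

(b) Let the completed lines `Lu` and `Lv` be contained in a subspace of `Σ(L,S)`, where `S` is
strong. Some `w = v - a` with `a ∈ L*u` is a unit, and for `t ∈ L` different from 0 and 1 the
subspace contains in turn the completed lines `ta + Lw` (through `ta` and `tv`), `v + La` (through
`v` and `ta + w`) and `Lw` (through `0` and `v - a`), which differs from both `Lu` and `Lv`. So two
points of the subspace are never joined by exactly two of its chains.
-/

namespace ChainStructure

variable {A B : ChainStructure}

/-- The set of all chains of `A` that join the points `p` and `q`. -/
def chainsThrough (A : ChainStructure) (p q : A.Point) : Set (Set A.Point) :=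
  {C ∈ A.chains | p ∈ C ∧ q ∈ C}

theorem mem_chainsThrough {p q : A.Point} {C : Set A.Point} :
    C ∈ A.chainsThrough p q ↔ C ∈ A.chains ∧ p ∈ C ∧ q ∈ C := Iff.rfl

theorem Iso.image_mem_chainsThrough (f : Iso A B) {C : Set A.Point} {p q : A.Point} :
    f.toEquiv '' C ∈ B.chainsThrough (f.toEquiv p) (f.toEquiv q) ↔ C ∈ A.chainsThrough p q := by
  simp only [mem_chainsThrough, f.map_chains, f.toEquiv.injective.mem_set_image]

theorem Iso.ncard_chainsThrough (f : Iso A B) (p q : A.Point) :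
    (B.chainsThrough (f.toEquiv p) (f.toEquiv q)).ncard = (A.chainsThrough p q).ncard := by
  have preimage_eq : (f.toEquiv '' ·) ⁻¹' B.chainsThrough (f.toEquiv p) (f.toEquiv q) =
      A.chainsThrough p q := Set.ext fun _ => f.image_mem_chainsThrough
  rw [← preimage_eq, Set.ncard_preimage_of_injective_subset_range
    f.toEquiv.injective.image_injective]
  exact fun C _ => f.toEquiv.surjective.image_surjective C

theorem Iso.distant (f : Iso A B) {p q : A.Point} (h : A.Distant p q) :
    B.Distant (f.toEquiv p) (f.toEquiv q) := by
  obtain ⟨hpq, C, hC⟩ := h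
  exact ⟨f.toEquiv.injective.ne hpq, _, f.image_mem_chainsThrough.2 hC⟩

theorem IsSubspace.preimage {U : Set B.Point} (hU : B.IsSubspace U) (f : Iso A B) :
    A.IsSubspace (f.toEquiv ⁻¹' U) := by
  intro p hp q hq r hr hpq hpr hqr C hC hpC hqC hrC
  rw [← Set.image_subset_iff]
  exact hU _ hp _ hq _ hr (f.distant hpq) (f.distant hpr) (f.distant hqr) _
    ((f.map_chains C).2 hC) (Set.mem_image_of_mem _ hpC) (Set.mem_image_of_mem _ hqC)
    (Set.mem_image_of_mem _ hrC)

theorem IsSubspace.chain_subset {U : Set A.Point} (hU : A.IsSubspace U) {C : Set A.Point}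
    (hC : C ∈ A.chains) {p q r : A.Point} (hp : p ∈ C ∩ U) (hq : q ∈ C ∩ U) (hr : r ∈ C ∩ U)
    (hpq : p ≠ q) (hpr : p ≠ r) (hqr : q ≠ r) : C ⊆ U :=
  hU p hp.2 q hq.2 r hr.2 ⟨hpq, C, hC, hp.1, hq.1⟩ ⟨hpr, C, hC, hp.1, hr.1⟩
    ⟨hqr, C, hC, hq.1, hr.1⟩ C hC hp.1 hq.1 hr.1

namespace induced

/-- The inclusion of the points of the structure induced on `U` into the points of `A`. -/
def inclusion (A : ChainStructure) (U : Set A.Point) : (A.induced U).Point → A.Point :=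
  Subtype.val

variable {U : Set A.Point}

theorem inclusion_injective : Function.Injective (inclusion A U) :=
  Subtype.val_injective

theorem range_inclusion : Set.range (inclusion A U) = U :=
  Subtype.range_val

theorem image_inclusion_mem_chains {C : Set (A.induced U).Point} :
    inclusion A U '' C ∈ A.chains ↔ C ∈ (A.induced U).chains := Iff.rfl

theorem ncard_chainsThrough (p q : (A.induced U).Point) :
    ((A.induced U).chainsThrough p q).ncard =
      (A.chainsThrough (inclusion A U p) (inclusion A U q) ∩ 𝒫 U).ncard := by
  have preimage_eq : (inclusion A U '' ·) ⁻¹'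
      (A.chainsThrough (inclusion A U p) (inclusion A U q) ∩ 𝒫 U) =
        (A.induced U).chainsThrough p q := by
    ext C
    have image_subset : inclusion A U '' C ⊆ U :=
      (Set.image_subset_range _ C).trans range_inclusion.subset
    simp only [Set.mem_preimage, Set.mem_inter_iff, Set.mem_powerset_iff, image_subset, and_true,
      mem_chainsThrough, image_inclusion_mem_chains, inclusion_injective.mem_set_image]
  rw [← preimage_eq, Set.ncard_preimage_of_injective_subset_range
    inclusion_injective.image_injective]
  rintro C ⟨-, hCU⟩
  exact ⟨_, Set.image_preimage_eq_of_subset (hCU.trans range_inclusion.superset)⟩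

end induced

end ChainStructure

theorem cyclicSubmodule_units_mul {R : Type*} [Ring R] (u : Rˣ) (a b : R) :
    cyclicSubmodule (u * a) (u * b) = cyclicSubmodule a b := by
  rw [cyclicSubmodule, cyclicSubmodule, ← Submodule.span_singleton_group_smul_eq R u ![a, b]]
  simp [Units.smul_def]

theorem exists_mul_eq_of_cyclicSubmodule_eq {R : Type*} [Ring R] {a b c d : R}
    (h : cyclicSubmodule a b = cyclicSubmodule c d) : ∃ r, r * c = a ∧ r * d = b := by
  have hmem : ![a, b] ∈ cyclicSubmodule c d := h ▸ Submodule.mem_span_singleton_self _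
  obtain ⟨r, hr⟩ := Submodule.mem_span_singleton.1 hmem
  exact ⟨r, congrFun hr 0, congrFun hr 1⟩

theorem glAct_cyclicSubmodule {R : Type*} [Ring R] (γ : (Matrix (Fin 2) (Fin 2) R)ˣ) (a b : R) :
    glAct γ (cyclicSubmodule a b) =
      cyclicSubmodule (a * γ.1 0 0 + b * γ.1 1 0) (a * γ.1 0 1 + b * γ.1 1 1) := by
  rw [glAct, cyclicSubmodule, Submodule.map_span, Set.image_singleton, cyclicSubmodule,
    Matrix.vecMulLinear_apply, Matrix.vecMul_eq_sum, Fin.sum_univ_two]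
  congr 2
  ext j
  fin_cases j <;> simp

theorem glAct_one {R : Type*} [Ring R] (p : Submodule R (Fin 2 → R)) : glAct 1 p = p := by
  have vecMulLinear_one : Matrix.vecMulLinear (1 : Matrix (Fin 2) (Fin 2) R) = LinearMap.id :=
    LinearMap.ext Matrix.vecMul_one
  rw [glAct, Units.val_one, vecMulLinear_one, Submodule.map_id]

theorem glAct_mul {R : Type*} [Ring R] (γ δ : (Matrix (Fin 2) (Fin 2) R)ˣ)
    (p : Submodule R (Fin 2 → R)) : glAct (γ * δ) p = glAct δ (glAct γ p) := by
  rw [glAct, glAct, glAct, ← Submodule.map_comp]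
  congr 1
  exact LinearMap.ext fun v => (Matrix.vecMul_vecMul v γ.1 δ.1).symm

/-- The translation `R(1,x) ↦ R(1,x + c)`. -/
def translation {R : Type*} [Ring R] (c : R) : (Matrix (Fin 2) (Fin 2) R)ˣ where
  val := !![1, c; 0, 1]
  inv := !![1, -c; 0, 1]
  val_inv := by simp [Matrix.one_fin_two]
  inv_val := by simp [Matrix.one_fin_two]

/-- The scaling `R(1,x) ↦ R(1,xu)` by a unit. -/
def scaling {R : Type*} [Ring R] (u : Rˣ) : (Matrix (Fin 2) (Fin 2) R)ˣ where
  val := !![1, 0; 0, ↑u]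
  inv := !![1, 0; 0, ↑u⁻¹]
  val_inv := by simp [Matrix.one_fin_two]
  inv_val := by simp [Matrix.one_fin_two]

/-- The exchange of the coordinates, that is, the inversion `R(1,x) ↦ R(x,1)`. -/
def coordSwap (R : Type*) [Ring R] : (Matrix (Fin 2) (Fin 2) R)ˣ where
  val := !![0, 1; 1, 0]
  inv := !![0, 1; 1, 0]
  val_inv := by simp [Matrix.one_fin_two]
  inv_val := by simp [Matrix.one_fin_two]

theorem isUnit_of_isUnit_diagonal {n R : Type*} [Fintype n] [DecidableEq n] [Semiring R] {d : n → R}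
    (h : IsUnit (Matrix.diagonal d)) (j : n) : IsUnit (d j) := by
  obtain ⟨M, hdM, hMd⟩ := isUnit_iff_exists.1 h
  refine isUnit_iff_exists.2 ⟨M j j, ?_, ?_⟩
  · rw [← Matrix.diagonal_mul, hdM, Matrix.one_apply_eq]
  · rw [← Matrix.mul_diagonal, hMd, Matrix.one_apply_eq]

/-- The multiplicative group of `K`, as a subgroup of the group of units of `R`. -/
def scalarUnits {K R : Type*} [DivisionRing K] [Ring R] (i : K →+* R) : Subgroup Rˣ :=
  (Units.map (i : K →* R)).range

namespace scalarUnits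

variable {K R : Type*} [DivisionRing K] [Ring R] {i : K →+* R}

theorem mem_iff [Nontrivial R] {u : Rˣ} : u ∈ scalarUnits i ↔ ∃ k, i k = u := by
  constructor
  · rintro ⟨k, rfl⟩
    exact ⟨k, rfl⟩
  · rintro ⟨k, hk⟩
    have hk0 : k ≠ 0 := by
      rintro rfl
      exact u.ne_zero (hk.symm.trans (map_zero i))
    exact ⟨Units.mk0 k hk0, Units.ext hk⟩

theorem exists_mul_map_eq_map_mul [(scalarUnits i).Normal] (a : Rˣ) (k : K) :
    ∃ l, a * i k = i l * a := by
  obtain rfl | hk := eq_or_ne k 0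
  · exact ⟨0, by simp⟩
  obtain ⟨l, hl⟩ := ‹(scalarUnits i).Normal›.conj_mem _ ⟨Units.mk0 k hk, rfl⟩ a
  refine ⟨l, ?_⟩
  have h : i l = a * i k * ↑a⁻¹ := congrArg Units.val hl
  rw [h, Units.inv_mul_cancel_right]

theorem range_mul_map [(scalarUnits i).Normal] (a : Rˣ) :
    (Set.range fun k => (a : R) * i k) = Set.range fun k => i k * a := by
  refine Set.Subset.antisymm ?_ ?_
  · rintro _ ⟨k, rfl⟩
    obtain ⟨l, hl⟩ := exists_mul_map_eq_map_mul (i := i) a k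
    exact ⟨l, hl.symm⟩
  · rintro _ ⟨k, rfl⟩
    obtain ⟨l, hl⟩ := exists_mul_map_eq_map_mul (i := i) a⁻¹ k
    exact ⟨l, ((Units.inv_mul_eq_iff_eq_mul a).1 (by rw [← mul_assoc, hl,
      Units.inv_mul_cancel_right])).symm⟩

instance normal_algebraMap {L S : Type*} [Field L] [Ring S] [Algebra L S] :
    (scalarUnits (algebraMap L S)).Normal where
  conj_mem := by
    rintro _ ⟨k, rfl⟩ u
    refine ⟨k, Units.ext ?_⟩
    simp [← Algebra.commutes]

theorem card_eq [Nontrivial R] : Nat.card (scalarUnits i) = Nat.card Kˣ :=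
  Nat.card_range_of_injective (Units.map_injective i.injective)

end scalarUnits

section Quadratic

variable {L S : Type*} [Field L] [Ring S] [Nontrivial S] [Algebra L S]

theorem not_isUnit_add_of_index_scalarUnits_eq_two
    (h : (scalarUnits (algebraMap L S)).index = 2) {u : Sˣ}
    (hu : u ∉ scalarUnits (algebraMap L S)) {a : L} (ha : a ≠ 0) :
    ¬ IsUnit ((u : S) + algebraMap L S a) := by
  rintro ⟨w, hw⟩
  have w_notMem : w ∉ scalarUnits (algebraMap L S) := by
    intro hmem
    obtain ⟨k, hk⟩ := scalarUnits.mem_iff.1 hmem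
    exact hu (scalarUnits.mem_iff.2 ⟨k - a, by rw [map_sub, hk, hw, add_sub_cancel_right]⟩)
  have mul_inv_mem : w * u⁻¹ ∈ scalarUnits (algebraMap L S) :=
    (Subgroup.mul_mem_iff_of_index_two h).2 (by simp [w_notMem, hu])
  obtain ⟨k, hk⟩ := scalarUnits.mem_iff.1 mul_inv_mem
  have map_sub_one : algebraMap L S (k - 1) = algebraMap L S a * ↑u⁻¹ := by
    rw [map_sub, hk, map_one, Units.val_mul, hw, add_mul, Units.mul_inv, add_sub_cancel_left]
  refine hu (inv_mem_iff.1 (scalarUnits.mem_iff.2 ⟨a⁻¹ * (k - 1), ?_⟩))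
  rw [map_mul, map_sub_one, ← mul_assoc, ← map_mul, inv_mul_cancel₀ ha, map_one, one_mul]

theorem map_mul_self_eq_of_index_scalarUnits_eq_two
    (h : (scalarUnits (algebraMap L S)).index = 2) {u : Sˣ}
    (hu : u ∉ scalarUnits (algebraMap L S)) {a : L} (ha : a ≠ 0) :
    algebraMap L S (a * a) = u * u := by
  obtain ⟨c, hc⟩ := scalarUnits.mem_iff.1 (Subgroup.mul_self_mem_of_index_two h u)
  rw [← Units.val_mul, ← hc]
  congr 1
  by_contra hne
  have hcomm : Commute (u : S) (algebraMap L S a) := (Algebra.commutes a (u : S)).symm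
  have factorization : ((u : S) + algebraMap L S a) * (u - algebraMap L S a) =
      algebraMap L S (c - a * a) := by
    rw [← hcomm.mul_self_sub_mul_self_eq, map_sub, map_mul, hc, Units.val_mul]
  have product_isUnit : IsUnit (((u : S) + algebraMap L S a) * (u - algebraMap L S a)) :=
    factorization ▸ (sub_ne_zero.2 (Ne.symm hne)).isUnit.map _
  have factors_commute : Commute ((u : S) + algebraMap L S a) (u - algebraMap L S a) :=
    ((Commute.refl _).sub_right hcomm).add_left (hcomm.symm.sub_right (Commute.refl _))
  exact not_isUnit_add_of_index_scalarUnits_eq_two h hu ha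
    (factors_commute.isUnit_mul_iff.1 product_isUnit).1

theorem card_le_three_of_index_scalarUnits_eq_two
    (h : (scalarUnits (algebraMap L S)).index = 2) : ENat.card L ≤ 3 := by
  obtain ⟨u, hu⟩ : ∃ u, u ∉ scalarUnits (algebraMap L S) := by
    by_contra! hall
    simp [(Subgroup.eq_top_iff' _).2 hall] at h
  have eq_one_or_neg_one {a : L} (ha : a ≠ 0) : a = 1 ∨ a = -1 := by
    refine mul_self_eq_mul_self_iff.1 ((algebraMap L S).injective ?_)
    rw [map_mul_self_eq_of_index_scalarUnits_eq_two h hu ha,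
      map_mul_self_eq_of_index_scalarUnits_eq_two h hu one_ne_zero]
  classical
  have univ_subset : (Set.univ : Set L) ⊆ ({0, 1, -1} : Finset L) := by
    intro a _
    simpa using or_iff_not_imp_left.2 eq_one_or_neg_one
  rw [← Set.encard_univ]
  exact (Set.encard_le_encard univ_subset).trans
    ((Set.encard_coe_eq_coe_finsetCard _).trans_le (mod_cast Finset.card_le_three))

end Quadratic

namespace IsStrongAlgebra

variable {L S : Type*} [Field L] [Ring S] [Algebra L S]

theorem exists_ne_zero_ne_one [Nontrivial S] (h : IsStrongAlgebra L S) :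
    ∃ t : L, t ≠ 0 ∧ t ≠ 1 := by
  obtain ⟨k, l, hkl, hk, hl⟩ := h 0
  have hk0 : k ≠ 0 := by rintro rfl; simp at hk
  have hl0 : l ≠ 0 := by rintro rfl; simp at hl
  exact ⟨k / l, div_ne_zero hk0 hl0, by rwa [Ne, div_eq_one_iff_eq hl0]⟩

theorem exists_ne_zero_isUnit_add (h : IsStrongAlgebra L S) (a : S) :
    ∃ k : L, k ≠ 0 ∧ IsUnit (a + algebraMap L S k) := by
  obtain ⟨k, l, hkl, hk, hl⟩ := h a
  obtain rfl | hk0 := eq_or_ne k 0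
  · exact ⟨l, hkl.symm, hl⟩
  · exact ⟨k, hk0, hk⟩

end IsStrongAlgebra

namespace chainGeometry

open scoped Pointwise
open MulOpposite

variable {K R : Type*} [DivisionRing K] [Ring R] (i : K →+* R)

/-- A point of the chain geometry, regarded as a submodule of `R²`. -/
def toSubmodule : (chainGeometry i).Point → Submodule R (Fin 2 → R) :=
  Subtype.val

/-- The point `R(0,1)`. -/
def infty : (chainGeometry i).Point :=
  ⟨cyclicSubmodule 0 1, coordSwap R, by simp [glAct_cyclicSubmodule, coordSwap]⟩

/-- The point `R(1,x)`. -/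
def affine (x : R) : (chainGeometry i).Point :=
  ⟨cyclicSubmodule 1 x, translation x, by simp [glAct_cyclicSubmodule, translation]⟩

/-- The affine line `c + Ku`, completed by the point `R(0,1)`. -/
def affineChain (c u : R) : Set (chainGeometry i).Point :=
  insert (infty i) (Set.range fun k : K => affine i (c + i k * u))

/-- The right action of `GL₂(R)` on the points, written as a left action of the opposite group. -/
instance : MulAction (Matrix (Fin 2) (Fin 2) R)ˣᵐᵒᵖ (chainGeometry i).Point where
  smul g p := ⟨glAct g.unop p.1, by
    obtain ⟨δ, hδ⟩ := p.2
    exact ⟨δ * g.unop, by rw [hδ, glAct_mul]⟩⟩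
  one_smul p := Subtype.ext (glAct_one p.1)
  mul_smul g h p := Subtype.ext (glAct_mul h.unop g.unop p.1)

variable {i}

theorem toSubmodule_injective : Function.Injective (toSubmodule i) :=
  Subtype.val_injective

theorem toSubmodule_infty : toSubmodule i (infty i) = cyclicSubmodule 0 1 := rfl

theorem toSubmodule_affine (x : R) : toSubmodule i (affine i x) = cyclicSubmodule 1 x := rfl

theorem toSubmodule_smul (g : (Matrix (Fin 2) (Fin 2) R)ˣᵐᵒᵖ) (p : (chainGeometry i).Point) :
    toSubmodule i (g • p) = glAct g.unop (toSubmodule i p) := rfl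

theorem affine_injective : Function.Injective (affine i) := by
  intro x y h
  obtain ⟨r, hr, hry⟩ := exists_mul_eq_of_cyclicSubmodule_eq (congrArg (toSubmodule i) h)
  rw [← hry, ← mul_one r, hr, one_mul]

theorem affine_ne_infty [Nontrivial R] (x : R) : affine i x ≠ infty i := by
  intro h
  obtain ⟨r, hr, -⟩ := exists_mul_eq_of_cyclicSubmodule_eq (congrArg (toSubmodule i) h)
  exact zero_ne_one ((mul_zero r).symm.trans hr)

theorem toSubmodule_smul_infty (g : (Matrix (Fin 2) (Fin 2) R)ˣᵐᵒᵖ) :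
    toSubmodule i (g • infty i) = cyclicSubmodule (g.unop.1 1 0) (g.unop.1 1 1) := by
  rw [toSubmodule_smul, toSubmodule_infty, glAct_cyclicSubmodule]
  simp only [zero_mul, one_mul, zero_add]

theorem toSubmodule_smul_affine (g : (Matrix (Fin 2) (Fin 2) R)ˣᵐᵒᵖ) (x : R) :
    toSubmodule i (g • affine i x) =
      cyclicSubmodule (g.unop.1 0 0 + x * g.unop.1 1 0) (g.unop.1 0 1 + x * g.unop.1 1 1) := by
  rw [toSubmodule_smul, toSubmodule_affine, glAct_cyclicSubmodule, one_mul, one_mul]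

theorem translation_smul_infty (c : R) : op (translation c) • infty i = infty i :=
  toSubmodule_injective (by simp [toSubmodule_smul_infty, toSubmodule_infty, translation])

theorem translation_smul_affine (c x : R) :
    op (translation c) • affine i x = affine i (c + x) :=
  toSubmodule_injective (by simp [toSubmodule_smul_affine, toSubmodule_affine, translation])

theorem scaling_smul_infty (u : Rˣ) : op (scaling u) • infty i = infty i :=
  toSubmodule_injective (by
    simpa [toSubmodule_smul_infty, toSubmodule_infty, scaling] using
      cyclicSubmodule_units_mul u 0 1)

theorem scaling_smul_affine (u : Rˣ) (x : R) :
    op (scaling u) • affine i x = affine i (x * u) :=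
  toSubmodule_injective (by simp [toSubmodule_smul_affine, toSubmodule_affine, scaling])

theorem coordSwap_smul_infty : op (coordSwap R) • infty i = affine i 0 :=
  toSubmodule_injective (by simp [toSubmodule_smul_infty, toSubmodule_affine, coordSwap])

theorem coordSwap_smul_affine_zero : op (coordSwap R) • affine i 0 = infty i :=
  toSubmodule_injective (by simp [toSubmodule_smul_affine, toSubmodule_infty, coordSwap])

theorem coordSwap_smul_affine_units (u : Rˣ) :
    op (coordSwap R) • affine i u = affine i ↑u⁻¹ :=
  toSubmodule_injective (by
    simpa [toSubmodule_smul_affine, toSubmodule_affine, coordSwap] using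
      cyclicSubmodule_units_mul u 1 ↑u⁻¹)

theorem infty_mem_affineChain (c u : R) : infty i ∈ affineChain i c u :=
  Set.mem_insert _ _

theorem affine_mem_affineChain [Nontrivial R] {c u x : R} :
    affine i x ∈ affineChain i c u ↔ ∃ k, c + i k * u = x := by
  rw [affineChain, Set.mem_insert_iff, or_iff_right (affine_ne_infty x), Set.mem_range]
  simp only [affine_injective.eq_iff]

theorem translation_smul_affineChain (d c u : R) :
    op (translation d) • affineChain i c u = affineChain i (d + c) u := by
  rw [affineChain, Set.smul_set_insert, Set.smul_set_range, affineChain]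
  simp only [translation_smul_infty, translation_smul_affine, add_assoc]

theorem scaling_smul_affineChain (v : Rˣ) (c u : R) :
    op (scaling v) • affineChain i c u = affineChain i (c * v) (u * v) := by
  rw [affineChain, Set.smul_set_insert, Set.smul_set_range, affineChain]
  simp only [scaling_smul_infty, scaling_smul_affine, add_mul, mul_assoc]

theorem affineChain_add_map_mul (c u : R) (k : K) :
    affineChain i (c + i k * u) u = affineChain i c u := by
  rw [affineChain, affineChain]
  congr 1
  refine Eq.trans ?_ ((Equiv.addLeft k).surjective.range_comp _)
  simp [Function.comp_def, add_mul, add_assoc]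

theorem affineChain_map_mul (c u : R) {k : K} (hk : k ≠ 0) :
    affineChain i c (i k * u) = affineChain i c u := by
  rw [affineChain, affineChain]
  congr 1
  refine Eq.trans ?_ ((Equiv.mulRight₀ k hk).surjective.range_comp _)
  simp [Function.comp_def, mul_assoc]

theorem image_toSubmodule_affineChain_zero_one :
    toSubmodule i '' affineChain i 0 1 = standardChain i := by
  rw [affineChain, Set.image_insert_eq, ← Set.range_comp]
  ext p
  constructor
  · rintro (rfl | ⟨k, rfl⟩)
    · exact ⟨0, 1, by simp, by simp [toSubmodule_infty]⟩
    · exact ⟨1, k, by simp, by simp [toSubmodule_affine]⟩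
  · rintro ⟨k, l, hkl, rfl⟩
    obtain rfl | hk := eq_or_ne k 0
    · have hl : l ≠ 0 := by simpa using hkl
      left
      simpa [toSubmodule_infty] using
        cyclicSubmodule_units_mul (Units.map (i : K →* R) (Units.mk0 l hl)) 0 1
    · right
      refine ⟨k⁻¹ * l, ?_⟩
      simpa [toSubmodule_affine, ← map_mul, mul_inv_cancel_left₀ hk] using
        (cyclicSubmodule_units_mul (Units.map (i : K →* R) (Units.mk0 k hk)) 1 (i (k⁻¹ * l))).symm

theorem mem_chains_iff {C : Set (chainGeometry i).Point} : C ∈ (chainGeometry i).chains ↔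
    ∃ g : (Matrix (Fin 2) (Fin 2) R)ˣᵐᵒᵖ, g • affineChain i 0 1 = C := by
  have image_smul (g : (Matrix (Fin 2) (Fin 2) R)ˣᵐᵒᵖ) :
      toSubmodule i '' (g • affineChain i 0 1) = glAct g.unop '' standardChain i := by
    rw [← image_toSubmodule_affineChain_zero_one, ← Set.image_smul, Set.image_image,
      Set.image_image]
    simp only [toSubmodule_smul]
  constructor
  · rintro ⟨γ, hγ⟩
    exact ⟨op γ, toSubmodule_injective.image_injective ((image_smul (op γ)).trans hγ.symm)⟩
  · rintro ⟨g, rfl⟩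
    exact ⟨g.unop, image_smul g⟩

theorem affineChain_mem_chains (c : R) (u : Rˣ) : affineChain i c u ∈ (chainGeometry i).chains := by
  refine mem_chains_iff.2 ⟨op (translation c) * op (scaling u), ?_⟩
  rw [mul_smul, scaling_smul_affineChain, translation_smul_affineChain, zero_mul, one_mul, add_zero]

/-- The automorphism of the chain geometry induced by an element of `GL₂(R)`. -/
def projectivity (g : (Matrix (Fin 2) (Fin 2) R)ˣᵐᵒᵖ) :
    ChainStructure.Iso (chainGeometry i) (chainGeometry i) where
  toEquiv := MulAction.toPerm g
  map_chains C := by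
    rw [mem_chains_iff, mem_chains_iff]
    change (∃ h, h • affineChain i 0 1 = g • C) ↔ _
    constructor
    · rintro ⟨h, hC⟩
      exact ⟨g⁻¹ * h, by rw [mul_smul, hC, inv_smul_smul]⟩
    · rintro ⟨h, rfl⟩
      exact ⟨g * h, mul_smul g h _⟩

theorem encard_of_mem_chains [Nontrivial R] {C : Set (chainGeometry i).Point}
    (hC : C ∈ (chainGeometry i).chains) : C.encard = ENat.card K + 1 := by
  obtain ⟨g, rfl⟩ := mem_chains_iff.1 hC
  have param_injective : Function.Injective fun k : K => affine i (0 + i k * 1) :=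
    fun k l hkl => i.injective (by simpa using affine_injective hkl)
  rw [Set.encard_smul_set, affineChain, Set.encard_insert_of_notMem, ← Set.image_univ,
    param_injective.encard_image, Set.encard_univ]
  rintro ⟨k, hk⟩
  exact affine_ne_infty _ hk

theorem translation_mem_stabilizer (k : K) :
    op (translation (i k)) ∈ MulAction.stabilizer _ (affineChain i 0 1) := by
  rw [MulAction.mem_stabilizer_iff, translation_smul_affineChain]
  simpa using affineChain_add_map_mul (i := i) 0 1 k

theorem coordSwap_mem_stabilizer [Nontrivial R] :
    op (coordSwap R) ∈ MulAction.stabilizer _ (affineChain i 0 1) := by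
  have swap_smul_subset : op (coordSwap R) • affineChain i 0 1 ⊆ affineChain i 0 1 := by
    rw [affineChain, Set.smul_set_insert, Set.smul_set_range, ← affineChain]
    refine Set.insert_subset ?_ ?_
    · rw [coordSwap_smul_infty]
      exact affine_mem_affineChain.2 ⟨0, by simp⟩
    · rintro _ ⟨k, rfl⟩
      obtain rfl | hk := eq_or_ne k 0
      · simpa [coordSwap_smul_affine_zero] using infty_mem_affineChain 0 1
      · have swap_smul := coordSwap_smul_affine_units (i := i)
          (Units.map (i : K →* R) (Units.mk0 k hk))
        refine Set.mem_of_eq_of_mem (by simpa using swap_smul) (affine_mem_affineChain.2 ⟨k⁻¹, ?_⟩)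
        simp
  have swap_mul_swap : op (coordSwap R) * op (coordSwap R) = 1 :=
    unop_injective (Units.ext (by simp [coordSwap, Matrix.one_fin_two]))
  refine MulAction.mem_stabilizer_iff.2 (swap_smul_subset.antisymm ?_)
  calc affineChain i 0 1
      = op (coordSwap R) • op (coordSwap R) • affineChain i 0 1 := by
        rw [smul_smul, swap_mul_swap, one_smul]
    _ ⊆ op (coordSwap R) • affineChain i 0 1 := Set.smul_set_mono swap_smul_subset

theorem exists_mem_stabilizer_smul_eq [Nontrivial R] {p q : (chainGeometry i).Point}
    (hp : p ∈ affineChain i 0 1) (hq : q ∈ affineChain i 0 1) (hpq : p ≠ q) :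
    ∃ g ∈ MulAction.stabilizer (Matrix (Fin 2) (Fin 2) R)ˣᵐᵒᵖ (affineChain i 0 1),
      g • infty i = p ∧ g • affine i 0 = q := by
  obtain rfl | ⟨k, rfl⟩ := hp <;> obtain rfl | ⟨l, rfl⟩ := hq
  · exact absurd rfl hpq
  · exact ⟨_, translation_mem_stabilizer l, translation_smul_infty _,
      by simp [translation_smul_affine]⟩
  · exact ⟨_, mul_mem (translation_mem_stabilizer k) coordSwap_mem_stabilizer,
      by simp [mul_smul, coordSwap_smul_infty, translation_smul_affine],
      by simp [mul_smul, coordSwap_smul_affine_zero, translation_smul_infty]⟩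
  · have hlk : l - k ≠ 0 := sub_ne_zero.2 (by rintro rfl; exact hpq rfl)
    have swap_smul : op (coordSwap R) • affine i (i (l - k)⁻¹) = affine i (i (l - k)) := by
      simpa using coordSwap_smul_affine_units (i := i)
        (Units.map (i : K →* R) (Units.mk0 (l - k) hlk)⁻¹)
    refine ⟨_, mul_mem (mul_mem (translation_mem_stabilizer k) coordSwap_mem_stabilizer)
      (translation_mem_stabilizer (l - k)⁻¹), ?_, ?_⟩
    · simp [mul_smul, translation_smul_infty, coordSwap_smul_infty, translation_smul_affine]
    · simp only [mul_smul, translation_smul_affine, add_zero, swap_smul]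
      simp

theorem exists_smul_eq_of_mem_chainsThrough [Nontrivial R] {C : Set (chainGeometry i).Point}
    {p q : (chainGeometry i).Point} (hC : C ∈ (chainGeometry i).chainsThrough p q) (hpq : p ≠ q) :
    ∃ g : (Matrix (Fin 2) (Fin 2) R)ˣᵐᵒᵖ,
      g • affineChain i 0 1 = C ∧ g • infty i = p ∧ g • affine i 0 = q := by
  obtain ⟨hC, hp, hq⟩ := hC
  obtain ⟨g, rfl⟩ := mem_chains_iff.1 hC
  rw [Set.mem_smul_set_iff_inv_smul_mem] at hp hq
  obtain ⟨h, hh, hhp, hhq⟩ := exists_mem_stabilizer_smul_eq hp hq (by simpa using hpq)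
  refine ⟨g * h, ?_, ?_, ?_⟩
  · rw [mul_smul, MulAction.mem_stabilizer_iff.1 hh]
  · rw [mul_smul, hhp, smul_inv_smul]
  · rw [mul_smul, hhq, smul_inv_smul]

theorem exists_smul_affine_eq_of_fixes {g : (Matrix (Fin 2) (Fin 2) R)ˣᵐᵒᵖ}
    (h_infty : g • infty i = infty i) (h_zero : g • affine i 0 = affine i 0) :
    ∃ a b : Rˣ, ∀ x : R, g • affine i x = affine i (a * x * b) := by
  have lower_left : g.unop.1 1 0 = 0 := by
    have h := congrArg (toSubmodule i) h_infty
    rw [toSubmodule_smul_infty, toSubmodule_infty] at h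
    obtain ⟨r, hr, -⟩ := exists_mul_eq_of_cyclicSubmodule_eq h
    rw [← hr, mul_zero]
  have upper_right : g.unop.1 0 1 = 0 := by
    have h := congrArg (toSubmodule i) h_zero
    rw [toSubmodule_smul_affine, toSubmodule_affine, zero_mul, zero_mul, add_zero, add_zero] at h
    obtain ⟨r, -, hr⟩ := exists_mul_eq_of_cyclicSubmodule_eq h
    rw [← hr, mul_zero]
  have diagonal_eq : g.unop.1 = Matrix.diagonal fun j => g.unop.1 j j := by
    ext j k
    fin_cases j <;> fin_cases k <;> simp [lower_left, upper_right]
  have diagonal_isUnit := isUnit_of_isUnit_diagonal (diagonal_eq ▸ g.unop.isUnit)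
  obtain ⟨a, ha⟩ := diagonal_isUnit 0
  obtain ⟨b, hb⟩ := diagonal_isUnit 1
  refine ⟨a⁻¹, b, fun x => toSubmodule_injective ?_⟩
  rw [toSubmodule_smul_affine, toSubmodule_affine, lower_left, upper_right, ← ha, ← hb]
  simpa [mul_assoc] using cyclicSubmodule_units_mul a 1 (↑a⁻¹ * x * b)

theorem mem_chainsThrough_infty_zero [Nontrivial R] [(scalarUnits i).Normal]
    {C : Set (chainGeometry i).Point} :
    C ∈ (chainGeometry i).chainsThrough (infty i) (affine i 0) ↔
      ∃ u : Rˣ, affineChain i 0 u = C := by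
  constructor
  · intro hC
    obtain ⟨g, rfl, h_infty, h_zero⟩ :=
      exists_smul_eq_of_mem_chainsThrough hC (affine_ne_infty 0).symm
    obtain ⟨a, b, hg⟩ := exists_smul_affine_eq_of_fixes h_infty h_zero
    refine ⟨a * b, ?_⟩
    have range_affine : (Set.range fun k => affine i (a * i k * b)) =
        Set.range fun k => affine i (i k * a * b) := by
      have h := congrArg (Set.image fun x => affine i (x * b))
        (scalarUnits.range_mul_map (i := i) a)
      simpa only [← Set.range_comp, Function.comp_def] using h
    rw [affineChain, affineChain, Set.smul_set_insert, Set.smul_set_range, h_infty]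
    simp only [hg, zero_add, mul_one, Units.val_mul, ← mul_assoc, range_affine]
  · rintro ⟨u, rfl⟩
    exact ⟨affineChain_mem_chains 0 u, infty_mem_affineChain 0 _,
      affine_mem_affineChain.2 ⟨0, by simp⟩⟩

theorem affineChain_zero_eq_iff [Nontrivial R] {u v : Rˣ} :
    affineChain i 0 u = affineChain i 0 v ↔ ∃ k, i k * u = v := by
  constructor
  · intro h
    have v_mem : affine i v ∈ affineChain i 0 u := h ▸ affine_mem_affineChain.2 ⟨1, by simp⟩
    simpa using affine_mem_affineChain.1 v_mem
  · rintro ⟨k, hk⟩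
    have hk0 : k ≠ 0 := by
      rintro rfl
      exact v.ne_zero (by rw [← hk, map_zero, zero_mul])
    rw [← hk, affineChain_map_mul _ _ hk0]

theorem ncard_chainsThrough_infty_zero [Nontrivial R] [(scalarUnits i).Normal] :
    ((chainGeometry i).chainsThrough (infty i) (affine i 0)).ncard = (scalarUnits i).index := by
  have chainsThrough_eq : (chainGeometry i).chainsThrough (infty i) (affine i 0) =
      Set.range fun u : Rˣ => affineChain i 0 u :=
    Set.ext fun _ => mem_chainsThrough_infty_zero
  have ker_eq : Setoid.ker (fun u : Rˣ => affineChain i 0 u) =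
      QuotientGroup.rightRel (scalarUnits i) := by
    ext u v
    rw [Setoid.ker_def, affineChain_zero_eq_iff, QuotientGroup.rightRel_apply, scalarUnits.mem_iff]
    simp only [Units.val_mul, Units.eq_mul_inv_iff_mul_eq]
  rw [chainsThrough_eq, ← Nat.card_coe_set_eq,
    ← Nat.card_congr (Setoid.quotientKerEquivRange _), ker_eq]
  exact Nat.card_congr (QuotientGroup.quotientRightRelEquivQuotientLeftRel _)

theorem ncard_chainsThrough [Nontrivial R] [(scalarUnits i).Normal] {p q : (chainGeometry i).Point}
    (h : (chainGeometry i).Distant p q) :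
    ((chainGeometry i).chainsThrough p q).ncard = (scalarUnits i).index := by
  obtain ⟨hpq, C, hC⟩ := h
  obtain ⟨g, -, rfl, rfl⟩ := exists_smul_eq_of_mem_chainsThrough hC hpq
  rw [← ncard_chainsThrough_infty_zero]
  exact (projectivity g).ncard_chainsThrough (infty i) (affine i 0)

theorem distant_infty_zero [Nontrivial R] : (chainGeometry i).Distant (infty i) (affine i 0) :=
  ⟨(affine_ne_infty 0).symm, _, affineChain_mem_chains 0 1, infty_mem_affineChain 0 _,
    affine_mem_affineChain.2 ⟨0, by simp⟩⟩

section Subspace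

variable [Nontrivial R] {U : Set (chainGeometry i).Point}

theorem affineChain_subset_of_isSubspace (hU : (chainGeometry i).IsSubspace U)
    (h_infty : infty i ∈ U) {c : R} {u : Rˣ} {k l : K} (hkl : k ≠ l)
    (hk : affine i (c + i k * u) ∈ U) (hl : affine i (c + i l * u) ∈ U) :
    affineChain i c u ⊆ U := by
  refine hU.chain_subset (affineChain_mem_chains c u) ⟨infty_mem_affineChain c _, h_infty⟩
    ⟨affine_mem_affineChain.2 ⟨k, rfl⟩, hk⟩ ⟨affine_mem_affineChain.2 ⟨l, rfl⟩, hl⟩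
    (affine_ne_infty _).symm (affine_ne_infty _).symm (affine_injective.ne ?_)
  simpa using i.injective.ne hkl

theorem affineChain_zero_subset_of_sub_eq (hU : (chainGeometry i).IsSubspace U) {a b w : Rˣ}
    (ha : affineChain i 0 a ⊆ U) (hb : affineChain i 0 b ⊆ U) (hw : (w : R) = b - a) {t : K}
    (ht0 : t ≠ 0) (ht1 : t ≠ 1) : affineChain i 0 w ⊆ U := by
  have h_infty : infty i ∈ U := ha (infty_mem_affineChain 0 _)
  have ta_mem : affine i (i t * a) ∈ U := ha (affine_mem_affineChain.2 ⟨t, by simp⟩)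
  have tb_mem : affine i (i t * b) ∈ U := hb (affine_mem_affineChain.2 ⟨t, by simp⟩)
  have b_mem : affine i b ∈ U := hb (affine_mem_affineChain.2 ⟨1, by simp⟩)
  have zero_mem : affine i 0 ∈ U := ha (affine_mem_affineChain.2 ⟨0, by simp⟩)
  have through_ta_tb : affineChain i (i t * a) w ⊆ U :=
    affineChain_subset_of_isSubspace hU h_infty ht0.symm (by simpa using ta_mem)
      (by simpa [hw, mul_sub] using tb_mem)
  have ta_add_w_mem : affine i (b + i (t - 1) * a) ∈ U :=
    through_ta_tb (affine_mem_affineChain.2 ⟨1, by rw [hw, map_sub, map_one]; noncomm_ring⟩)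
  have through_b_ta_add_w : affineChain i b a ⊆ U :=
    affineChain_subset_of_isSubspace hU h_infty (sub_ne_zero.2 ht1).symm (by simpa using b_mem)
      ta_add_w_mem
  have w_mem : affine i w ∈ U :=
    through_b_ta_add_w (affine_mem_affineChain.2 ⟨-1, by simp [hw, sub_eq_add_neg]⟩)
  exact affineChain_subset_of_isSubspace hU h_infty (zero_ne_one (α := K))
    (by simpa using zero_mem) (by simpa using w_mem)

end Subspace

section Algebra

variable {L S : Type*} [Field L] [Ring S] [Nontrivial S] [Algebra L S]
  {U : Set (chainGeometry (algebraMap L S)).Point}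

theorem exists_affineChain_zero_subset_ne (hS : IsStrongAlgebra L S)
    (hU : (chainGeometry (algebraMap L S)).IsSubspace U) {u v : Sˣ}
    (hu : affineChain (algebraMap L S) 0 u ⊆ U) (hv : affineChain (algebraMap L S) 0 v ⊆ U)
    (huv : affineChain (algebraMap L S) 0 u ≠ affineChain (algebraMap L S) 0 v) :
    ∃ w : Sˣ, affineChain (algebraMap L S) 0 w ⊆ U ∧
      affineChain (algebraMap L S) 0 w ≠ affineChain (algebraMap L S) 0 u ∧
      affineChain (algebraMap L S) 0 w ≠ affineChain (algebraMap L S) 0 v := by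
  obtain ⟨t, ht0, ht1⟩ := hS.exists_ne_zero_ne_one
  obtain ⟨k, hk, w', hw'⟩ := hS.exists_ne_zero_isUnit_add (v * u⁻¹ : Sˣ)
  have hw : ((w' * u : Sˣ) : S) = v + algebraMap L S k * u := by
    simp [hw', add_mul]
  obtain ⟨a, ha⟩ : ∃ a : Sˣ, (a : S) = algebraMap L S (-k) * u :=
    ⟨Units.map (algebraMap L S : L →* S) (Units.mk0 (-k) (neg_ne_zero.2 hk)) * u, rfl⟩
  refine ⟨w' * u, ?_, fun h => huv ?_, fun h => huv ?_⟩
  · refine affineChain_zero_subset_of_sub_eq hU (a := a) ?_ hv ?_ ht0 ht1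
    · rwa [ha, affineChain_map_mul _ _ (neg_ne_zero.2 hk)]
    · rw [hw, ha, map_neg, neg_mul, sub_neg_eq_add]
  · obtain ⟨m, hm⟩ := affineChain_zero_eq_iff.1 h.symm
    refine affineChain_zero_eq_iff.2 ⟨m - k, ?_⟩
    rw [map_sub, sub_mul, hm, hw, add_sub_cancel_right]
  · obtain ⟨m, hm⟩ := affineChain_zero_eq_iff.1 h.symm
    refine (affineChain_zero_eq_iff.2 ⟨k⁻¹ * (m - 1), ?_⟩).symm
    have map_sub_one_mul : algebraMap L S (m - 1) * v = algebraMap L S k * u := by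
      rw [map_sub, map_one, sub_mul, hm, hw, one_mul, add_sub_cancel_left]
    rw [map_mul, mul_assoc, map_sub_one_mul, ← mul_assoc, ← map_mul, inv_mul_cancel₀ hk, map_one,
      one_mul]

theorem exists_third_chain (hS : IsStrongAlgebra L S)
    (hU : (chainGeometry (algebraMap L S)).IsSubspace U)
    {p q : (chainGeometry (algebraMap L S)).Point} (hpq : p ≠ q)
    {C D : Set (chainGeometry (algebraMap L S)).Point} (hCD : C ≠ D)
    (hC : C ∈ (chainGeometry (algebraMap L S)).chainsThrough p q ∩ 𝒫 U)
    (hD : D ∈ (chainGeometry (algebraMap L S)).chainsThrough p q ∩ 𝒫 U) :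
    ∃ E ∈ (chainGeometry (algebraMap L S)).chainsThrough p q ∩ 𝒫 U, E ≠ C ∧ E ≠ D := by
  obtain ⟨g, -, rfl, rfl⟩ := exists_smul_eq_of_mem_chainsThrough hC.1 hpq
  have smul_mem_iff (E : Set (chainGeometry (algebraMap L S)).Point) :
      g • E ∈ (chainGeometry (algebraMap L S)).chainsThrough
          (g • infty _) (g • affine _ 0) ∩ 𝒫 U ↔
        (∃ u : Sˣ, affineChain (algebraMap L S) 0 u = E) ∧ E ⊆ g⁻¹ • U := by
    rw [← mem_chainsThrough_infty_zero, ← Set.smul_set_subset_iff_subset_inv_smul_set]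
    exact and_congr_left' (projectivity g).image_mem_chainsThrough
  have hU' : (chainGeometry (algebraMap L S)).IsSubspace (g⁻¹ • U) := by
    rw [← Set.preimage_smul]
    exact hU.preimage (projectivity g)
  obtain ⟨C, rfl⟩ := MulAction.surjective g C
  obtain ⟨D, rfl⟩ := MulAction.surjective g D
  obtain ⟨⟨u, rfl⟩, huU⟩ := (smul_mem_iff C).1 hC
  obtain ⟨⟨v, rfl⟩, hvU⟩ := (smul_mem_iff D).1 hD
  obtain ⟨w, hwU, hwu, hwv⟩ := exists_affineChain_zero_subset_ne hS hU' huU hvU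
    (ne_of_apply_ne _ hCD)
  exact ⟨g • affineChain (algebraMap L S) 0 w, (smul_mem_iff _).2 ⟨⟨w, rfl⟩, hwU⟩,
    (MulAction.injective g).ne hwu, (MulAction.injective g).ne hwv⟩

theorem ncard_chainsThrough_induced_ne_two (hS : IsStrongAlgebra L S)
    (hU : (chainGeometry (algebraMap L S)).IsSubspace U)
    {p q : ((chainGeometry (algebraMap L S)).induced U).Point} (hpq : p ≠ q) :
    (((chainGeometry (algebraMap L S)).induced U).chainsThrough p q).ncard ≠ 2 := by
  rw [ChainStructure.induced.ncard_chainsThrough]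
  intro h
  obtain ⟨C, D, hCD, h_pair⟩ := Set.ncard_eq_two.1 h
  obtain ⟨E, hE, hEC, hED⟩ := exists_third_chain hS hU
    (ChainStructure.induced.inclusion_injective.ne hpq) hCD
    (h_pair ▸ Set.mem_insert C {D}) (h_pair ▸ Set.mem_insert_of_mem C rfl)
  rw [h_pair] at hE
  exact hE.elim hEC hED

end Algebra

section Iso

variable [Nontrivial R] {K' R' : Type*} [DivisionRing K'] [Ring R'] [Nontrivial R']
  {j : K' →+* R'}

theorem index_scalarUnits_eq_of_iso [(scalarUnits i).Normal] [(scalarUnits j).Normal]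
    (f : ChainStructure.Iso (chainGeometry i) (chainGeometry j)) :
    (scalarUnits i).index = (scalarUnits j).index := by
  rw [← ncard_chainsThrough distant_infty_zero, ← f.ncard_chainsThrough,
    ncard_chainsThrough (f.distant distant_infty_zero)]

theorem card_eq_of_iso (f : ChainStructure.Iso (chainGeometry i) (chainGeometry j)) :
    ENat.card K = ENat.card K' := by
  have hC : affineChain i 0 (1 : Rˣ) ∈ (chainGeometry i).chains := affineChain_mem_chains 0 1
  have h : (ENat.card K' + 1 : ℕ∞) = ENat.card K + 1 := by
    rw [← encard_of_mem_chains hC, ← encard_of_mem_chains ((f.map_chains _).2 hC),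
      f.toEquiv.injective.encard_image]
  exact (ENat.add_left_injective_of_ne_top ENat.one_ne_top h).symm

end Iso

end chainGeometry

theorem card_galoisField_two_two : Nat.card (GaloisField 2 2) = 4 :=
  GaloisField.card 2 2 two_ne_zero

theorem index_scalarUnits_galoisField (ι : GaloisField 2 2 →+* Matrix (Fin 2) (Fin 2) (ZMod 2)) :
    (scalarUnits ι).index = 2 := by
  have card_scalarUnits : Nat.card (scalarUnits ι) = 3 := by
    rw [scalarUnits.card_eq, Nat.card_units, card_galoisField_two_two]
  have card_units : Nat.card (Matrix (Fin 2) (Fin 2) (ZMod 2))ˣ = 6 := by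
    have h := Matrix.card_GL_field (𝔽 := ZMod 2) 2
    simpa [Fin.prod_univ_two] using h
  have h := (scalarUnits ι).card_mul_index
  rw [card_scalarUnits, card_units] at h
  omega

theorem mainTheorem6_general {K R : Type*} [DivisionRing K] [Ring R] [Nontrivial R] (i : K →+* R)
    (h : (scalarUnits i).index = 2) :
    (3 < ENat.card K → ∀ (L : Type*) (S : Type*) [Field L] [Ring S] [Nontrivial S] [Algebra L S],
      ¬ Nonempty (ChainStructure.Iso (chainGeometry i) (chainGeometry (algebraMap L S)))) ∧
    (∀ (L : Type*) (S : Type*) [Field L] [Ring S] [Nontrivial S] [Algebra L S],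
      IsStrongAlgebra L S →
        ¬ ChainStructure.EmbedsAsSubspace (chainGeometry i) (chainGeometry (algebraMap L S))) := by
  have : (scalarUnits i).Normal := Subgroup.normal_of_index_eq_two h
  refine ⟨?_, ?_⟩
  · rintro hK L S _ _ _ _ ⟨f⟩
    have hL : ENat.card L ≤ 3 := card_le_three_of_index_scalarUnits_eq_two
      ((chainGeometry.index_scalarUnits_eq_of_iso f).symm.trans h)
    exact hK.not_ge ((chainGeometry.card_eq_of_iso f).trans_le hL)
  · rintro L S _ _ _ _ hS ⟨U, hU, ⟨f⟩⟩
    have distant := chainGeometry.distant_infty_zero (i := i)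
    refine chainGeometry.ncard_chainsThrough_induced_ne_two hS hU (f.distant distant).1 ?_
    rw [f.ncard_chainsThrough, chainGeometry.ncard_chainsThrough distant, h]

theorem mainTheorem6 (ι : GaloisField 2 2 →+* Matrix (Fin 2) (Fin 2) (ZMod 2)) :
    (∀ (L : Type*) (S : Type*) [Field L] [Ring S] [Nontrivial S] [Algebra L S],
      ¬ Nonempty (ChainStructure.Iso (chainGeometry ι) (chainGeometry (algebraMap L S)))) ∧
    (∀ (L : Type*) (S : Type*) [Field L] [Ring S] [Nontrivial S] [Algebra L S],
      IsStrongAlgebra L S →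
        ¬ ChainStructure.EmbedsAsSubspace (chainGeometry ι) (chainGeometry (algebraMap L S))) := by
  have hK : 3 < ENat.card (GaloisField 2 2) := by
    rw [ENat.card_eq_coe_natCard, card_galoisField_two_two]
    norm_num
  exact (mainTheorem6_general ι (index_scalarUnits_galoisField ι)).imp_left fun h => h hK
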